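/- All channels are binary-input discrete memoryless channels $W$ with input alphabet $\{0,1\}$ (uniform input) and a discrete output alphabet. Write $W\preccurlyeq W'$ ($W$ is a degradation of $W'$) if $\Pr_W(y\mid a)=\sum_{y'}\Pr_{W'}(y'\mid a)K(y\mid y')$ for some channel $K$, and $W\cong W'$ if the two channels have the same likelihood-ratio profile, i.e. for every $\varepsilon\in[0,1]$ the probabilities that the output $y$ satisfies $\Pr(y\mid 0)/\Pr(y\mid 1)=\varepsilon/(1-\varepsilon)$ coincide. Let $P_\epsilon(W)=\frac12\sum_y\min\{\Pr(y\mid0),\Pr(y\mid1)\}$. Let $\sum_j p_j\mathrm B(\varepsilon_j)$ denote the channel that uses the binary symmetric channel $\mathrm B(\varepsilon_j)$ of crossover probability $\varepsilon_j$ with probability $p_j$ and reveals $j$ at the output; $\mathbb B_n$ is the set of channels equivalent to such a channel with $n$ terms. A $2n$-P-degradation of $Q$ is a $W\in\mathbb B_n$ with $W\preccurlyeq Q$ and $P_\epsilon(W)=\min\{P_\epsilon(V): V\in\mathbb B_n,\ V\preccurlyeq Q\}$. Let $2\le n<m$ and $Q\cong\sum_{i=1}^m q_i\mathrm B(\sigma_i)$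 with all $q_i>0$, $\sum_i q_i=1$ and $0\le\sigma_1<\dots<\sigma_m\le\frac12$; put $q_0=q_{m+1}=0$. For $1\le i_2<\dots<i_n\le m$ and $0\le s_j\le q_{i_j}$ $(2\le j\le n)$, put $i_1=s_1=0$, $i_{n+1}=m+1$, $s_{n+1}=0$, and let $D_Q(i_2,\dots,i_n;s_2,\dots,s_n)=\sum_{j=1}^n p_j\mathrm B(\varepsilon_j)$, where $$p_j=s_j+\sum_{i_j<i<i_{j+1}}q_i+(q_{i_{j+1}}-s_{j+1}),\qquad p_j\varepsilon_j=s_j\sigma_{i_j}+\sum_{i_j<i<i_{j+1}}q_i\sigma_i+(q_{i_{j+1}}-s_{j+1})\sigma_{i_{j+1}}$$ (terms with index $0$ or $m+1$ being $0$). The pairs $(i_2,s_2),\dots,(i_n,s_n)$ are its splitting patterns. A channel $W\cong D_Q(i_2,\dots,i_n;s_2,\dots,s_n)$ is called a $2n$-P$^*$-degradation of $Q$ with these splitting patterns if it is a $2n$-P-degradation of $Q$, all $p_j>0$, $0\le\varepsilon_1<\dots<\varepsilon_n\le\frac12$, and for every $j\in\{1,\dots,n\}$ with $i_{j+1}=i_j+1$: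 1. if $s_j=0$, then $s_{j+1}=0$ and $p_j\mathrm B(\varepsilon_j)=q_{i_{j+1}}\mathrm B(\sigma_{i_{j+1}})$ (same weight and crossover probability); 2. if $s_{j+1}=q_{i_{j+1}}$, then $s_j=q_{i_j}$ and $p_j\mathrm B(\varepsilon_j)=q_{i_j}\mathrm B(\sigma_{i_j})$. **Theorem.** Let $W$ and $W'$ be $2n$-P$^*$-degradations of $Q$ such that at most two of the splitting patterns of $W$ are not splitting patterns of $W'$ (in particular, this holds if the two sequences of splitting patterns differ in at most two positions). If $W\preccurlyeq W'$, then $W\cong W'$. That is, one cannot obtain a $2n$-P$^*$-degradation $W'\not\cong W$ of $Q$ with $W\preccurlyeq W'$ by adjusting at most two splitting patterns of $W$. -/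

import Mathlib

noncomputable section

/-- A binary-input discrete memoryless channel with output alphabet `Y`:
`W a y = Pr(y | x = a)` for the inputs `a ∈ {0, 1}`. The input is uniformly distributed. -/
abbrev BIDMC (Y : Type*) := ZMod 2 → PMF Y

/-- The LR-profile `P_W(ε) = Pr(y ∈ L_W(ε))`, where `L_W(ε)` is the set of outputs with
`Pr(y | 0) / Pr(y | 1) = ε / (1 - ε)`. The equation between ratios is multiplied out, so that
`ε = 1` (infinite likelihood ratio) is covered; outputs that never occur contribute `0`. -/
def BIDMC.lrProfile {Y : Type*} (W : BIDMC Y) (ε : ℝ) : ENNReal :=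
  open scoped Classical in
  ∑' y, if (W 0 y).toReal * (1 - ε) = (W 1 y).toReal * ε then (W 0 y + W 1 y) / 2 else 0

/-- Equivalence `W ≅ W'` of channels: the LR-profiles coincide. -/
def BIDMC.Equivalent {Y Y' : Type*} (W : BIDMC Y) (W' : BIDMC Y') : Prop :=
  ∀ ε ∈ Set.Icc (0 : ℝ) 1, W.lrProfile ε = W'.lrProfile ε

/-- `W.IsDegradationOf W'` means `W ≼ W'`: `W` arises from `W'` by an intermediate channel `K`,
`Pr(y | a) = ∑ y', Pr(y' | a) * K(y | y')`. -/
def BIDMC.IsDegradationOf {Y Y' : Type*} (W : BIDMC Y) (W' : BIDMC Y') : Prop :=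
  ∃ K : Y' → PMF Y, ∀ a, W a = (W' a).bind K

/-- The error probability of maximum likelihood decoding. -/
def BIDMC.errorProb {Y : Type*} (W : BIDMC Y) : ENNReal :=
  (∑' y, min (W 0 y) (W 1 y)) / 2

/-- A formal expression `∑ j, p_j B(ε_j)`: weights `p_j ≥ 0` of sum `1` and crossover
probabilities `ε_j ∈ [0, 1]` of `n` binary symmetric channels. -/
structure BSCMix (n : ℕ) where
  weight : Fin n → ℝ
  cross : Fin n → ℝ
  weight_nonneg : ∀ j, 0 ≤ weight j
  weight_sum : ∑ j, weight j = 1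
  cross_nonneg : ∀ j, 0 ≤ cross j
  cross_le_one : ∀ j, cross j ≤ 1

/-- The random switching channel `∑ j, p_j B(ε_j)`. The output `(j, b)` consists of the index `j`
of the binary symmetric channel that was used and of its output bit `b`. -/
def BSCMix.channel {n : ℕ} (M : BSCMix n) : BIDMC (Fin n × ZMod 2) := fun a =>
  PMF.ofFintype
    (fun y => ENNReal.ofReal (M.weight y.1 * if y.2 = a then 1 - M.cross y.1 else M.cross y.1)) <| by
    have hnn : ∀ y : Fin n × ZMod 2,
        0 ≤ M.weight y.1 * if y.2 = a then 1 - M.cross y.1 else M.cross y.1 := by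
      intro y
      refine mul_nonneg (M.weight_nonneg _) ?_
      split_ifs
      · linarith [M.cross_le_one y.1]
      · exact M.cross_nonneg _
    rw [← ENNReal.ofReal_sum_of_nonneg fun y _ => hnn y, Fintype.sum_prod_type]
    have hin : ∀ j, ∑ b : ZMod 2,
        (M.weight j * if b = a then 1 - M.cross j else M.cross j) = M.weight j := by
      intro j
      rw [← Finset.mul_sum, ← Finset.add_sum_erase _ _ (Finset.mem_univ a), if_pos rfl,
        Finset.sum_congr rfl fun b hb => if_neg (Finset.ne_of_mem_erase hb), Finset.sum_const,
        Finset.card_erase_of_mem (Finset.mem_univ a), Finset.card_univ, ZMod.card]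
      simp
    simp only [hin, M.weight_sum, ENNReal.ofReal_one]

/-- All weights are positive and `0 ≤ ε_1 < ⋯ < ε_n ≤ 1/2`. -/
def BSCMix.IsReduced {n : ℕ} (M : BSCMix n) : Prop :=
  (∀ j, 0 < M.weight j) ∧ StrictMono M.cross ∧ ∀ j, M.cross j ≤ 1 / 2

/-- `W ∈ 𝔹_n`: `W` is equivalent to a random switching channel of `n` binary symmetric
channels. -/
def BIDMC.MemB {Y : Type*} (W : BIDMC Y) (n : ℕ) : Prop :=
  ∃ M : BSCMix n, W.Equivalent M.channel

/-- `W` is a `2n`-P-degradation of `Q`: a degradation in `𝔹_n` of the least error probability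
among the degradations in `𝔹_n`. -/
def BIDMC.IsPDegradationOf {Y A : Type*} (W : BIDMC Y) (n : ℕ) (Q : BIDMC A) : Prop :=
  W.MemB n ∧ W.IsDegradationOf Q ∧
    ∀ (Y' : Type) (W' : BIDMC Y'), W'.MemB n → W'.IsDegradationOf Q → W.errorProb ≤ W'.errorProb

/-- The numbers `a_1, …, a_m` as a function of an index `k ≥ 0`, with value `0` for `k = 0` and
for `k > m` (the convention `q_0 = q_{m+1} = 0`). -/
def padded {m : ℕ} (a : Fin m → ℝ) (k : ℕ) : ℝ :=
  if h : 1 ≤ k ∧ k ≤ m then a ⟨k - 1, by omega⟩ else 0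

/-- The sequences `0 = i_1 < i_2 < ⋯ < i_n < i_{n+1} = m + 1` and `s_1 = 0, s_2, …, s_n,
s_{n+1} = 0` with `0 ≤ s_j ≤ q_{i_j}`. The value of `i_j`, `s_j` is `idx`, `amt` at `j - 1`. -/
structure Splitting {m : ℕ} (M : BSCMix m) (n : ℕ) where
  idx : Fin (n + 1) → ℕ
  amt : Fin (n + 1) → ℝ
  idx_first : idx 0 = 0
  idx_last : idx (Fin.last n) = m + 1
  idx_strictMono : StrictMono idx
  amt_first : amt 0 = 0
  amt_last : amt (Fin.last n) = 0
  amt_nonneg : ∀ j, 0 ≤ amt j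
  amt_le : ∀ j, amt j ≤ padded M.weight (idx j)

namespace Splitting

variable {m n : ℕ} {M : BSCMix m}

/-- The splitting patterns `(i_2, s_2), …, (i_n, s_n)`. -/
def patterns (P : Splitting M n) : Set (ℕ × ℝ) :=
  {x | ∃ j, j ≠ 0 ∧ j ≠ Fin.last n ∧ x = (P.idx j, P.amt j)}

/-- The weight of `B(σ_k)` in the `j`-th segment, that is, in the
`(i_j, i_{j+1}; s_j, s_{j+1})`-segment. -/
def segWeight (P : Splitting M n) (j : Fin n) (k : ℕ) : ℝ :=
  if k = P.idx j.castSucc then P.amt j.castSucc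
  else if k = P.idx j.succ then padded M.weight k - P.amt j.succ
  else if P.idx j.castSucc < k ∧ k < P.idx j.succ then padded M.weight k
  else 0

/-- `D = ∑ j, p_j B(ε_j)` is the expression in which each `p_j B(ε_j)` is compounded from the
`j`-th segment. -/
def Compounds (P : Splitting M n) (D : BSCMix n) : Prop :=
  ∀ j, D.weight j = ∑ k ∈ Finset.range (m + 2), P.segWeight j k ∧
    D.weight j * D.cross j = ∑ k ∈ Finset.range (m + 2), P.segWeight j k * padded M.cross k

/-- The conditions on adjacent splitting indices: if `i_{j+1} = i_j + 1` for some `j ∈ [n]`, then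
`s_{j+1} = 0` and `p_j B(ε_j) = q_{i_{j+1}} B(σ_{i_{j+1}})` when `s_j = 0`, and
`s_j = q_{i_j}` and `p_j B(ε_j) = q_{i_j} B(σ_{i_j})` when `s_{j+1} = q_{i_{j+1}}`. -/
def AdjacencyConditions (P : Splitting M n) (D : BSCMix n) : Prop :=
  ∀ j : Fin n, P.idx j.succ = P.idx j.castSucc + 1 →
    (P.amt j.castSucc = 0 →
      P.amt j.succ = 0 ∧ D.weight j = padded M.weight (P.idx j.succ) ∧
        D.cross j = padded M.cross (P.idx j.succ)) ∧
    (P.amt j.succ = padded M.weight (P.idx j.succ) →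
      P.amt j.castSucc = padded M.weight (P.idx j.castSucc) ∧
        D.weight j = padded M.weight (P.idx j.castSucc) ∧
        D.cross j = padded M.cross (P.idx j.castSucc))

end Splitting

/-- `W` is the `2n`-P*-degradation `D_Q(i_2, …, i_n; s_2, …, s_n)` of `Q ≅ M.channel`, given by
the splitting patterns `P`. -/
def BIDMC.IsPStarDegradation {m n : ℕ} {A Y : Type*} (W : BIDMC Y) (Q : BIDMC A)
    {M : BSCMix m} (P : Splitting M n) : Prop :=
  W.IsPDegradationOf n Q ∧
    ∃ D : BSCMix n, D.IsReduced ∧ P.Compounds D ∧ P.AdjacencyConditions D ∧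
      W.Equivalent D.channel

end

/-!
Arrange the binary symmetric channels of `∑ j, p_j B(ε_j)` by increasing crossover probability as
consecutive intervals (atoms) of lengths `p_j` in `[0, 1]`. Integrating the crossover probability
gives the Lorenz curve of the expression, a convex piecewise linear function, and a degradation has
the larger Lorenz curve. The splitting patterns of `D_Q` are points `x_j` of `[0, 1]`, and the
Lorenz curve of `D_Q` interpolates that of `Q` linearly between them.

Let `D ≼ D'` be given by the points `x_j` and `x'_j`. At each `x_j` the interpolation for `D'` lies
below the Lorenz curve of `Q`, and by convexity also above it. So if `x_j` is strictly between two
consecutive points of `D'`, the Lorenz curve of `Q` is linear there, that is, both points belong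
to one atom of `Q`. The adjacency conditions say that a segment contained in an atom is the whole
atom. Hence a segment `[x_j, x_{j+1}]` contained in `[x'_j, x'_{j+1}]` is equal to it, and since
both sequences have the same length and the same ends, they coincide.
-/

theorem exists_eq_add_mul_ofReal {a b : ENNReal} (ha : a ≠ ⊤) (hb : b ≠ ⊤) :
    ∃ ε ∈ Set.Icc (0 : ℝ) 1,
      a = (a + b) * ENNReal.ofReal ε ∧ b = (a + b) * ENNReal.ofReal (1 - ε) := by
  by_cases h0 : a + b = 0
  · obtain ⟨rfl, rfl⟩ := add_eq_zero.mp h0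
    exact ⟨0, by simp⟩
  have htop : a + b ≠ ⊤ := ENNReal.add_ne_top.mpr ⟨ha, hb⟩
  have hle : a / (a + b) ≤ 1 := ENNReal.div_le_of_le_mul (by simp)
  have hfst : (a + b) * (a / (a + b)) = a := ENNReal.mul_div_cancel h0 htop
  have hsnd : (a + b) * (1 - a / (a + b)) = b := by
    rw [ENNReal.mul_sub fun _ _ => htop, mul_one, hfst, ENNReal.add_sub_cancel_left ha]
  refine ⟨(a / (a + b)).toReal, ⟨ENNReal.toReal_nonneg, ENNReal.toReal_le_of_le_ofReal zero_le_one
    (by simpa using hle)⟩, ?_, ?_⟩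
  · rw [ENNReal.ofReal_toReal (hle.trans_lt ENNReal.one_lt_top).ne, hfst]
  · rw [ENNReal.ofReal_sub _ ENNReal.toReal_nonneg, ENNReal.ofReal_one,
      ENNReal.ofReal_toReal (hle.trans_lt ENNReal.one_lt_top).ne, hsnd]

namespace BIDMC

theorem tsum_ite_likelihoodRatio_mul {φ : ENNReal → ENNReal → ENNReal}
    (hφ : ∀ c a b, φ (c * a) (c * b) = c * φ a b) {a b : ENNReal} (ha : a ≠ ⊤) (hb : b ≠ ⊤) :
    (∑' δ : Set.Icc (0 : ℝ) 1, open scoped Classical in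
      (if a.toReal * (1 - (δ : ℝ)) = b.toReal * δ then (a + b) / 2 else 0) *
        (2 * φ (ENNReal.ofReal δ) (ENNReal.ofReal (1 - δ)))) = φ a b := by
  by_cases h0 : a + b = 0
  · obtain ⟨rfl, rfl⟩ := add_eq_zero.mp h0
    simpa using (hφ 0 0 0).symm
  obtain ⟨ε, hε, hεa, hεb⟩ := exists_eq_add_mul_ofReal ha hb
  have hpos : 0 < (a + b).toReal := ENNReal.toReal_pos h0 (ENNReal.add_ne_top.mpr ⟨ha, hb⟩)
  have haε : a.toReal = (a + b).toReal * ε := by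
    rw [← ENNReal.toReal_ofReal hε.1, ← ENNReal.toReal_mul, ← hεa]
  have hbε : b.toReal = (a + b).toReal * (1 - ε) := by
    rw [← ENNReal.toReal_ofReal (sub_nonneg.mpr hε.2), ← ENNReal.toReal_mul, ← hεb]
  have hratio : ∀ δ : ℝ, a.toReal * (1 - δ) = b.toReal * δ ↔ δ = ε := fun δ => by
    rw [haε, hbε, mul_assoc, mul_assoc, mul_right_inj' hpos.ne']
    constructor <;> intro h <;> linarith
  simp only [hratio]
  rw [tsum_eq_single ⟨ε, hε⟩ fun δ hδ => by rw [if_neg (hδ ∘ Subtype.ext), zero_mul], if_pos rfl,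
    ← mul_assoc, ENNReal.div_mul_cancel two_ne_zero ENNReal.ofNat_ne_top, ← hφ, ← hεa, ← hεb]

variable {Y Y' : Type*}

theorem tsum_eq_tsum_lrProfile_mul (W : BIDMC Y) {φ : ENNReal → ENNReal → ENNReal}
    (hφ : ∀ c a b, φ (c * a) (c * b) = c * φ a b) :
    ∑' y, φ (W 0 y) (W 1 y) = ∑' ε : Set.Icc (0 : ℝ) 1,
      W.lrProfile ε * (2 * φ (ENNReal.ofReal ε) (ENNReal.ofReal (1 - ε))) := by
  simp only [lrProfile, ← ENNReal.tsum_mul_right]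
  rw [ENNReal.tsum_comm]
  exact tsum_congr fun y => (tsum_ite_likelihoodRatio_mul hφ ((W 0).apply_ne_top y)
    ((W 1).apply_ne_top y)).symm

theorem Equivalent.tsum_eq {W : BIDMC Y} {W' : BIDMC Y'} (h : W.Equivalent W')
    {φ : ENNReal → ENNReal → ENNReal} (hφ : ∀ c a b, φ (c * a) (c * b) = c * φ a b) :
    ∑' y, φ (W 0 y) (W 1 y) = ∑' y, φ (W' 0 y) (W' 1 y) := by
  rw [tsum_eq_tsum_lrProfile_mul W hφ, tsum_eq_tsum_lrProfile_mul W' hφ]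
  exact tsum_congr fun ε => by rw [h ε ε.2]

/-- The error functional `∑ y, min (Pr(y | 0)) (Pr(y | 1)) (t * (Pr(y | 0) + Pr(y | 1)))`, in which
the posterior error probability of each output is truncated at `t`. It grows under degradation,
and as a function of `t` it is dual to the Lorenz curve. There is no factor `1 / 2`, so
`t ≥ 1 / 2` gives `2 * W.errorProb`. -/
noncomputable def truncatedError (W : BIDMC Y) (t : ENNReal) : ENNReal :=
  ∑' y, min (min (W 0 y) (W 1 y)) (t * (W 0 y + W 1 y))

theorem Equivalent.truncatedError_eq {W : BIDMC Y} {W' : BIDMC Y'} (h : W.Equivalent W')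
    (t : ENNReal) : W.truncatedError t = W'.truncatedError t :=
  h.tsum_eq (φ := fun a b => min (min a b) (t * (a + b))) fun c a b => by
    rw [mul_min, mul_min, ← mul_add, mul_left_comm]

theorem IsDegradationOf.truncatedError_le {W : BIDMC Y} {W' : BIDMC Y'}
    (h : W.IsDegradationOf W') (t : ENNReal) :
    W'.truncatedError t ≤ W.truncatedError t := by
  obtain ⟨K, hK⟩ := h
  have hW : ∀ a y, W a y = ∑' y', W' a y' * K y' y := fun a y => by
    rw [hK a, PMF.bind_apply]
  calc W'.truncatedError t
      = ∑' y', ∑' y, min (min (W' 0 y') (W' 1 y')) (t * (W' 0 y' + W' 1 y')) * K y' y := by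
        refine tsum_congr fun y' => ?_
        rw [ENNReal.tsum_mul_left, PMF.tsum_coe, mul_one]
    _ = ∑' y, ∑' y', min (min (W' 0 y') (W' 1 y')) (t * (W' 0 y' + W' 1 y')) * K y' y :=
        ENNReal.tsum_comm
    _ ≤ W.truncatedError t := by
        refine ENNReal.tsum_le_tsum fun y => le_min (le_min ?_ ?_) ?_
        · rw [hW]
          gcongr
          exact (min_le_left _ _).trans (min_le_left _ _)
        · rw [hW]
          gcongr
          exact (min_le_left _ _).trans (min_le_right _ _)
        · rw [hW, hW, ← ENNReal.tsum_add, ← ENNReal.tsum_mul_left]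
          simp only [← add_mul, ← mul_assoc]
          gcongr
          exact min_le_right _ _

end BIDMC

section padded

variable {m : ℕ} (a : Fin m → ℝ)

theorem padded_val_succ (i : Fin m) : padded a (i + 1) = a i :=
  dif_pos ⟨by omega, i.isLt⟩

theorem padded_zero : padded a 0 = 0 :=
  dif_neg (by omega)

theorem padded_of_lt {k : ℕ} (h : m < k) : padded a k = 0 :=
  dif_neg (by omega)

theorem padded_nonneg {a : Fin m → ℝ} (ha : ∀ i, 0 ≤ a i) (k : ℕ) : 0 ≤ padded a k := by
  unfold padded
  split_ifs
  exacts [ha _, le_rfl]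

end padded

namespace BSCMix

variable {n : ℕ} (M : BSCMix n)

theorem truncatedError_channel {t : ℝ} (ht : 0 ≤ t) :
    M.channel.truncatedError (ENNReal.ofReal t) =
      ENNReal.ofReal (2 * ∑ j, M.weight j * min (min (M.cross j) (1 - M.cross j)) t) := by
  have hcross : ∀ j, 0 ≤ 1 - M.cross j := fun j => sub_nonneg.mpr (M.cross_le_one j)
  have houtput : ∀ y : Fin n × ZMod 2,
      min (min (M.channel 0 y) (M.channel 1 y))
        (ENNReal.ofReal t * (M.channel 0 y + M.channel 1 y)) =
      ENNReal.ofReal (M.weight y.1 * min (min (M.cross y.1) (1 - M.cross y.1)) t) := by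
    rintro ⟨j, b⟩
    have hw := M.weight_nonneg j
    have hsum : ENNReal.ofReal (M.weight j * M.cross j) +
        ENNReal.ofReal (M.weight j * (1 - M.cross j)) = ENNReal.ofReal (M.weight j) := by
      rw [← ENNReal.ofReal_add (mul_nonneg hw (M.cross_nonneg j)) (mul_nonneg hw (hcross j))]
      ring_nf
    rw [mul_min_of_nonneg _ _ hw, mul_min_of_nonneg _ _ hw, ENNReal.ofReal_min,
      ENNReal.ofReal_min, mul_comm (M.weight j) t, ENNReal.ofReal_mul ht, ← hsum]
    obtain rfl | rfl : b = 0 ∨ b = 1 := by decide +revert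
    · simp only [channel, PMF.ofFintype_apply, if_true, zero_ne_one, if_false]
      rw [min_comm (ENNReal.ofReal _), add_comm]
    · simp only [channel, PMF.ofFintype_apply, if_true, one_ne_zero, if_false]
  have hnonneg : ∀ j, 0 ≤ M.weight j * min (min (M.cross j) (1 - M.cross j)) t := fun j =>
    mul_nonneg (M.weight_nonneg j) (le_min (le_min (M.cross_nonneg j) (hcross j)) ht)
  rw [BIDMC.truncatedError, tsum_fintype, Finset.sum_congr rfl fun y _ => houtput y,
    ← ENNReal.ofReal_sum_of_nonneg fun y _ => hnonneg y.1, Fintype.sum_prod_type, Finset.mul_sum]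
  simp [ZMod.card]

/-- The cumulative weight `p_1 + ⋯ + p_k`, that is, the right end of the `k`-th atom. The sum is
padded with zeros, so the value is `1` for `k ≥ n`. -/
noncomputable def cumWeight (k : ℕ) : ℝ := ∑ i ∈ Finset.range k, padded M.weight (i + 1)

theorem cumWeight_zero : M.cumWeight 0 = 0 := Finset.sum_range_zero _

theorem cumWeight_succ (k : ℕ) : M.cumWeight (k + 1) = M.cumWeight k + padded M.weight (k + 1) :=
  Finset.sum_range_succ _ _

theorem cumWeight_val_succ (i : Fin n) : M.cumWeight (i + 1) = M.cumWeight i + M.weight i := by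
  rw [cumWeight_succ, padded_val_succ]

theorem cumWeight_eq_pred_add (k : ℕ) :
    M.cumWeight k = M.cumWeight (k - 1) + padded M.weight k := by
  cases k with
  | zero => rw [padded_zero, add_zero]
  | succ k => exact M.cumWeight_succ k

theorem cumWeight_mono : Monotone M.cumWeight :=
  monotone_nat_of_le_succ fun k => by
    rw [cumWeight_succ]
    exact le_add_of_nonneg_right (padded_nonneg M.weight_nonneg _)

theorem cumWeight_nonneg (k : ℕ) : 0 ≤ M.cumWeight k :=
  M.cumWeight_zero.symm.trans_le (M.cumWeight_mono k.zero_le)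

theorem cumWeight_self : M.cumWeight n = 1 := by
  rw [cumWeight, Finset.sum_range, ← M.weight_sum]
  exact Finset.sum_congr rfl fun i _ => padded_val_succ _ i

theorem cumWeight_card_succ : M.cumWeight (n + 1) = 1 := by
  rw [cumWeight_succ, cumWeight_self, padded_of_lt _ n.lt_succ_self, add_zero]

variable {M}

theorem cumWeight_strictMonoOn (hw : ∀ i, 0 < M.weight i) :
    StrictMonoOn M.cumWeight (Set.Iic n) := by
  intro k _ l hl hkl
  have hkn : k < n := hkl.trans_le hl
  have hpos := hw ⟨k, hkn⟩
  have hsucc := M.cumWeight_val_succ ⟨k, hkn⟩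
  have hle := M.cumWeight_mono (Nat.succ_le_of_lt hkl)
  simp only [Nat.succ_eq_add_one] at hle hsucc
  linarith

variable (M)

/-- The interval of `[0, 1]` that `p_i B(ε_i)` occupies when the terms of the expression are lined
up in their order. -/
abbrev atom (i : Fin n) : Set ℝ := Set.Icc (M.cumWeight i) (M.cumWeight (i + 1))

variable {M}

theorem mem_Icc_of_mem_atom {i : Fin n} {x : ℝ} (hx : x ∈ M.atom i) : x ∈ Set.Icc (0 : ℝ) 1 :=
  ⟨(M.cumWeight_nonneg _).trans hx.1,
    M.cumWeight_self ▸ hx.2.trans (M.cumWeight_mono i.isLt)⟩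

theorem exists_mem_atom {x : ℝ} (hx : x ∈ Set.Ioc (0 : ℝ) 1) : ∃ i, x ∈ M.atom i := by
  have hex : ∃ k, x ≤ M.cumWeight k := ⟨n, M.cumWeight_self.symm ▸ hx.2⟩
  obtain ⟨k, hk⟩ : ∃ k, Nat.find hex = k + 1 := Nat.exists_eq_succ_of_ne_zero fun h => by
    have := Nat.find_spec hex
    rw [h, cumWeight_zero] at this
    exact hx.1.not_ge this
  have hkn : k < n := by
    have := Nat.find_min' hex (M.cumWeight_self.symm ▸ hx.2)
    omega
  exact ⟨⟨k, hkn⟩, (not_le.mp (Nat.find_min hex (m := k) (by omega))).le, hk ▸ Nat.find_spec hex⟩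

variable (M)

/-- The length of the part of the `i`-th atom to the left of `x`. -/
noncomputable def portion (i : Fin n) (x : ℝ) : ℝ :=
  min x (M.cumWeight (i + 1)) - min x (M.cumWeight i)

variable {M}

theorem portion_of_le {i : Fin n} {x : ℝ} (h : x ≤ M.cumWeight i) : M.portion i x = 0 := by
  rw [portion, min_eq_left h, min_eq_left (h.trans (M.cumWeight_mono (Nat.le_succ _))), sub_self]

theorem portion_of_ge {i : Fin n} {x : ℝ} (h : M.cumWeight (i + 1) ≤ x) :
    M.portion i x = M.weight i := by
  rw [portion, min_eq_right h, min_eq_right ((M.cumWeight_mono (Nat.le_succ _)).trans h),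
    cumWeight_val_succ, add_sub_cancel_left]

theorem portion_of_mem_atom {i : Fin n} {x : ℝ} (h : x ∈ M.atom i) :
    M.portion i x = x - M.cumWeight i := by
  rw [portion, min_eq_left h.2, min_eq_right h.1]

theorem portion_of_mem_atom_of_lt {i l : Fin n} {x : ℝ} (h : x ∈ M.atom i) (hl : l < i) :
    M.portion l x = M.weight l :=
  portion_of_ge ((M.cumWeight_mono (Nat.succ_le_of_lt hl)).trans h.1)

theorem portion_of_mem_atom_of_gt {i l : Fin n} {x : ℝ} (h : x ∈ M.atom i) (hl : i < l) :
    M.portion l x = 0 :=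
  portion_of_le (h.2.trans (M.cumWeight_mono (Nat.succ_le_of_lt hl)))

variable (M)

theorem portion_nonneg (i : Fin n) (x : ℝ) : 0 ≤ M.portion i x :=
  sub_nonneg.mpr (min_le_min_left _ (M.cumWeight_mono (Nat.le_succ _)))

theorem portion_le_weight (i : Fin n) (x : ℝ) : M.portion i x ≤ M.weight i := by
  have hw := M.weight_nonneg i
  rcases le_total x (M.cumWeight i) with hx | hx
  · exact (portion_of_le hx).trans_le hw
  rcases le_total (M.cumWeight (i + 1)) x with hx' | hx'
  · exact (portion_of_ge hx').le
  · rw [portion_of_mem_atom ⟨hx, hx'⟩]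
    linarith [M.cumWeight_val_succ i]

variable {M}

theorem sum_portion {x : ℝ} (hx : x ∈ Set.Icc (0 : ℝ) 1) : ∑ i, M.portion i x = x := by
  have htelescope := Finset.sum_range_sub (fun k => min x (M.cumWeight k)) n
  rw [Finset.sum_range, cumWeight_self, cumWeight_zero, min_eq_left hx.2, min_eq_right hx.1,
    sub_zero] at htelescope
  exact htelescope

theorem sum_weight_sub_portion {x : ℝ} (hx : x ∈ Set.Icc (0 : ℝ) 1) :
    ∑ i, (M.weight i - M.portion i x) = 1 - x := by
  rw [Finset.sum_sub_distrib, M.weight_sum, sum_portion hx]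

theorem sum_portion_sub_portion {x y : ℝ} (hx : x ∈ Set.Icc (0 : ℝ) 1)
    (hy : y ∈ Set.Icc (0 : ℝ) 1) : ∑ i, (M.portion i y - M.portion i x) = y - x := by
  rw [Finset.sum_sub_distrib, sum_portion hx, sum_portion hy]

variable (M)

/-- The Lorenz curve of the expression: the integral from `0` to `x` of the step function whose
value on the `i`-th atom is the crossover probability `ε_i`. -/
noncomputable def lorenz (x : ℝ) : ℝ := ∑ i, M.portion i x * M.cross i

variable {M}

theorem lorenz_zero : M.lorenz 0 = 0 :=
  Finset.sum_eq_zero fun i _ => by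
    rw [portion_of_le (M.cumWeight_nonneg _), zero_mul]

theorem lorenz_sub_eq_of_mem_atom {i : Fin n} {x y : ℝ} (hx : x ∈ M.atom i) (hy : y ∈ M.atom i) :
    M.lorenz y - M.lorenz x = (y - x) * M.cross i := by
  simp only [lorenz, ← Finset.sum_sub_distrib, ← sub_mul]
  rw [Finset.sum_eq_single_of_mem i (Finset.mem_univ i), portion_of_mem_atom hx,
    portion_of_mem_atom hy, sub_sub_sub_cancel_right]
  intro l _ hl
  rcases hl.lt_or_gt with hl | hl
  · rw [portion_of_mem_atom_of_lt hx hl, portion_of_mem_atom_of_lt hy hl, sub_self, zero_mul]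
  · rw [portion_of_mem_atom_of_gt hx hl, portion_of_mem_atom_of_gt hy hl, sub_self, zero_mul]

theorem lorenz_sub_sub_mul_eq_sum {x y : ℝ} (hx : x ∈ Set.Icc (0 : ℝ) 1)
    (hy : y ∈ Set.Icc (0 : ℝ) 1) (c : ℝ) :
    M.lorenz y - M.lorenz x - c * (y - x) =
      ∑ l, (M.portion l y - M.portion l x) * (M.cross l - c) := by
  rw [← sum_portion_sub_portion (M := M) hx hy, lorenz, lorenz, Finset.mul_sum,
    ← Finset.sum_sub_distrib, ← Finset.sum_sub_distrib]
  exact Finset.sum_congr rfl fun l _ => by ring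

theorem portion_sub_mul_cross_sub_nonneg (hc : Monotone M.cross) {i : Fin n} {x : ℝ}
    (hx : x ∈ M.atom i) (y : ℝ) (l : Fin n) :
    0 ≤ (M.portion l y - M.portion l x) * (M.cross l - M.cross i) := by
  rcases lt_trichotomy l i with hl | rfl | hl
  · rw [portion_of_mem_atom_of_lt hx hl]
    exact mul_nonneg_of_nonpos_of_nonpos (sub_nonpos.mpr (M.portion_le_weight l y))
      (sub_nonpos.mpr (hc hl.le))
  · rw [sub_self, mul_zero]
  · rw [portion_of_mem_atom_of_gt hx hl, sub_zero]
    exact mul_nonneg (M.portion_nonneg l y) (sub_nonneg.mpr (hc hl.le))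

theorem cross_mul_sub_le_lorenz_sub (hc : Monotone M.cross) {i : Fin n} {x y : ℝ}
    (hx : x ∈ M.atom i) (hy : y ∈ Set.Icc (0 : ℝ) 1) :
    M.cross i * (y - x) ≤ M.lorenz y - M.lorenz x := by
  rw [← sub_nonneg, lorenz_sub_sub_mul_eq_sum (mem_Icc_of_mem_atom hx) hy]
  exact Finset.sum_nonneg fun l _ => portion_sub_mul_cross_sub_nonneg hc hx y l

theorem mem_atom_of_lorenz_sub_le (hc : StrictMono M.cross) {i : Fin n} {x y : ℝ}
    (hx : x ∈ M.atom i) (hy : y ∈ Set.Icc (0 : ℝ) 1)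
    (h : M.lorenz y - M.lorenz x ≤ M.cross i * (y - x)) : y ∈ M.atom i := by
  have hx' := mem_Icc_of_mem_atom hx
  have hnonneg := fun l (_ : l ∈ Finset.univ) =>
    portion_sub_mul_cross_sub_nonneg hc.monotone hx y l
  have hzero := (Finset.sum_eq_zero_iff_of_nonneg hnonneg).mp <|
    (Finset.sum_nonneg hnonneg).antisymm' <|
      lorenz_sub_sub_mul_eq_sum hx' hy _ ▸ sub_nonpos.mpr h
  have hportion : ∀ l ≠ i, M.portion l y = M.portion l x := fun l hl => sub_eq_zero.mp <|
    (mul_eq_zero.mp (hzero l (Finset.mem_univ l))).resolve_right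
      (sub_ne_zero.mpr (hc.injective.ne hl))
  have hsub : y - x = M.portion i y - M.portion i x := by
    rw [← sum_portion_sub_portion (M := M) hx' hy]
    exact Finset.sum_eq_single_of_mem i (Finset.mem_univ i) fun l _ hl =>
      sub_eq_zero.mpr (hportion l hl)
  rw [portion_of_mem_atom hx] at hsub
  have hsucc := M.cumWeight_val_succ i
  constructor
  · linarith [M.portion_nonneg i y]
  · linarith [M.portion_le_weight i y]

theorem exists_mem_atom_of_chord_le (hc : StrictMono M.cross) {a z b c : ℝ}
    (ha : a ∈ Set.Icc (0 : ℝ) 1) (hb : b ∈ Set.Icc (0 : ℝ) 1) (haz : a < z) (hzb : z < b)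
    (hleft : c * (z - a) ≤ M.lorenz z - M.lorenz a)
    (hright : M.lorenz b - M.lorenz z ≤ c * (b - z)) : ∃ i, a ∈ M.atom i ∧ b ∈ M.atom i := by
  obtain ⟨i, hi⟩ := exists_mem_atom (M := M) ⟨ha.1.trans_lt haz, hzb.le.trans hb.2⟩
  have hsub_a := cross_mul_sub_le_lorenz_sub hc.monotone hi ha
  have hsub_b := cross_mul_sub_le_lorenz_sub hc.monotone hi hb
  have hslope : c = M.cross i := by
    apply le_antisymm
    · exact le_of_mul_le_mul_right (by linarith) (sub_pos.mpr haz)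
    · exact le_of_mul_le_mul_right (by linarith) (sub_pos.mpr hzb)
  subst hslope
  exact ⟨i, mem_atom_of_lorenz_sub_le hc hi ha (by linarith),
    mem_atom_of_lorenz_sub_le hc hi hb hright⟩

theorem sum_weight_mul_min_le {x : ℝ} (hx : x ∈ Set.Icc (0 : ℝ) 1) (t : ℝ) :
    ∑ j, M.weight j * min (M.cross j) t ≤ M.lorenz x + t * (1 - x) := by
  rw [lorenz, ← sum_weight_sub_portion (M := M) hx, Finset.mul_sum, ← Finset.sum_add_distrib]
  refine Finset.sum_le_sum fun j _ => ?_
  have hcross := mul_le_mul_of_nonneg_left (min_le_left (M.cross j) t) (M.portion_nonneg j x)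
  have htrunc := mul_le_mul_of_nonneg_left (min_le_right (M.cross j) t)
    (sub_nonneg.mpr (M.portion_le_weight j x))
  linarith

theorem sum_weight_mul_min_cross_eq (hc : Monotone M.cross) {k : Fin n} {x : ℝ}
    (hx : x ∈ M.atom k) :
    ∑ j, M.weight j * min (M.cross j) (M.cross k) = M.lorenz x + M.cross k * (1 - x) := by
  rw [lorenz, ← sum_weight_sub_portion (M := M) (mem_Icc_of_mem_atom hx), Finset.mul_sum,
    ← Finset.sum_add_distrib]
  refine Finset.sum_congr rfl fun j _ => ?_
  rcases lt_trichotomy j k with hj | rfl | hj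
  · rw [portion_of_mem_atom_of_lt hx hj, min_eq_left (hc hj.le)]
    ring
  · rw [min_self]
    ring
  · rw [portion_of_mem_atom_of_gt hx hj, min_eq_right (hc hj.le)]
    ring

theorem lorenz_le_lorenz {n' : ℕ} {M' : BSCMix n'} (hc : Monotone M.cross)
    (h : ∀ t, 0 ≤ t →
      ∑ j, M.weight j * min (M.cross j) t ≤ ∑ j, M'.weight j * min (M'.cross j) t)
    {x : ℝ} (hx : x ∈ Set.Icc (0 : ℝ) 1) : M.lorenz x ≤ M'.lorenz x := by
  rcases hx.1.eq_or_lt with rfl | hpos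
  · rw [lorenz_zero, lorenz_zero]
  obtain ⟨k, hk⟩ := exists_mem_atom (M := M) ⟨hpos, hx.2⟩
  have hle := h _ (M.cross_nonneg k)
  rw [sum_weight_mul_min_cross_eq hc hk] at hle
  exact le_of_add_le_add_right (hle.trans (sum_weight_mul_min_le hx _))

theorem lorenz_le_lorenz_of_isDegradationOf {n' : ℕ} {M' : BSCMix n'} {Y Y' : Type*}
    {W : BIDMC Y} {W' : BIDMC Y'} (hM : ∀ j, M.cross j ≤ 1 / 2) (hc' : Monotone M'.cross)
    (hM' : ∀ j, M'.cross j ≤ 1 / 2) (hW : W.Equivalent M.channel) (hW' : W'.Equivalent M'.channel)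
    (hle : W.IsDegradationOf W') {x : ℝ} (hx : x ∈ Set.Icc (0 : ℝ) 1) :
    M'.lorenz x ≤ M.lorenz x := by
  refine lorenz_le_lorenz hc' (fun t ht => ?_) hx
  have hmin : ∀ c : ℝ, c ≤ 1 / 2 → min c (1 - c) = c := fun c hc => min_eq_left (by linarith)
  have htrunc := hle.truncatedError_le (ENNReal.ofReal t)
  rw [hW.truncatedError_eq, hW'.truncatedError_eq, truncatedError_channel _ ht,
    truncatedError_channel _ ht] at htrunc
  simp only [hmin _ (hM _), hmin _ (hM' _)] at htrunc
  rw [ENNReal.ofReal_le_ofReal_iff (mul_nonneg zero_le_two (Finset.sum_nonneg fun j _ =>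
    mul_nonneg (M.weight_nonneg j) (le_min (M.cross_nonneg j) ht)))] at htrunc
  linarith

end BSCMix

theorem eq_of_segment_subset_imp_eq {α : Type*} [LinearOrder α] {n : ℕ} {x x' : Fin (n + 1) → α}
    (hzero : x 0 = x' 0) (hlast : x (Fin.last n) = x' (Fin.last n))
    (h : ∀ j : Fin n, x' j.castSucc ≤ x j.castSucc → x j.succ ≤ x' j.succ →
      x j.castSucc = x' j.castSucc ∧ x j.succ = x' j.succ) : x = x' := by
  funext j
  apply le_antisymm
  · induction j using Fin.reverseInduction with
    | last => exact hlast.le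
    | cast j ih =>
      by_contra! hlt
      exact hlt.ne' (h j hlt.le ih).1
  · induction j using Fin.induction with
    | zero => exact hzero.ge
    | succ j ih =>
      by_contra! hlt
      exact hlt.ne (h j ih hlt.le).2

namespace Splitting

variable {m n : ℕ} {M : BSCMix m}

section position

variable (P : Splitting M n)

/-- The point `q_1 + ⋯ + q_{i_j} - s_j` of `[0, 1]` at which the `j`-th splitting pattern cuts:
of the `i_j`-th atom the weight `s_j` lies to the right of it. -/
noncomputable def pos (j : Fin (n + 1)) : ℝ := M.cumWeight (P.idx j) - P.amt j

theorem idx_castSucc_lt (j : Fin n) : P.idx j.castSucc < P.idx j.succ :=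
  P.idx_strictMono Fin.castSucc_lt_succ

theorem idx_le (j : Fin (n + 1)) : P.idx j ≤ m + 1 :=
  P.idx_last ▸ P.idx_strictMono.monotone (Fin.le_last j)

theorem amt_eq_zero {j : Fin (n + 1)} (h : padded M.weight (P.idx j) = 0) : P.amt j = 0 :=
  (h ▸ P.amt_le j).antisymm (P.amt_nonneg j)

theorem pos_le_cumWeight (j : Fin (n + 1)) : P.pos j ≤ M.cumWeight (P.idx j) :=
  sub_le_self _ (P.amt_nonneg j)

theorem pos_eq_cumWeight_pred_add (j : Fin (n + 1)) :
    P.pos j = M.cumWeight (P.idx j - 1) + (padded M.weight (P.idx j) - P.amt j) := by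
  rw [pos, M.cumWeight_eq_pred_add (P.idx j), add_sub_assoc]

theorem cumWeight_pred_le_pos (j : Fin (n + 1)) : M.cumWeight (P.idx j - 1) ≤ P.pos j := by
  rw [pos_eq_cumWeight_pred_add]
  exact le_add_of_nonneg_right (sub_nonneg.mpr (P.amt_le j))

theorem amt_eq_zero_iff_pos_eq (j : Fin (n + 1)) :
    P.amt j = 0 ↔ P.pos j = M.cumWeight (P.idx j) :=
  sub_eq_self.symm

theorem amt_eq_padded_iff_pos_eq (j : Fin (n + 1)) :
    P.amt j = padded M.weight (P.idx j) ↔ P.pos j = M.cumWeight (P.idx j - 1) := by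
  rw [pos_eq_cumWeight_pred_add, add_eq_left, sub_eq_zero, eq_comm]

theorem pos_zero : P.pos 0 = 0 := by
  rw [pos, P.idx_first, P.amt_first, M.cumWeight_zero, sub_zero]

theorem pos_last : P.pos (Fin.last n) = 1 := by
  rw [pos, P.idx_last, P.amt_last, M.cumWeight_card_succ, sub_zero]

theorem pos_mem_Icc (j : Fin (n + 1)) : P.pos j ∈ Set.Icc (0 : ℝ) 1 :=
  ⟨(M.cumWeight_nonneg _).trans (P.cumWeight_pred_le_pos j),
    (P.pos_le_cumWeight j).trans (M.cumWeight_card_succ ▸ M.cumWeight_mono (P.idx_le j))⟩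

theorem portion_pos (j : Fin (n + 1)) (i : Fin m) :
    M.portion i (P.pos j) = if i + 1 < P.idx j then M.weight i
      else if i + 1 = P.idx j then M.weight i - P.amt j else 0 := by
  have hle := P.pos_le_cumWeight j
  have hge := P.cumWeight_pred_le_pos j
  split_ifs with hlt heq
  · exact BSCMix.portion_of_ge ((M.cumWeight_mono (by omega)).trans hge)
  · rw [← heq] at hle hge
    rw [BSCMix.portion_of_mem_atom ⟨hge, hle⟩, pos, ← heq, M.cumWeight_val_succ]
    ring
  · exact BSCMix.portion_of_le (hle.trans (M.cumWeight_mono (by omega)))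

theorem segWeight_val_succ (j : Fin n) (i : Fin m) :
    P.segWeight j (i + 1) = M.portion i (P.pos j.succ) - M.portion i (P.pos j.castSucc) := by
  have hlt := P.idx_castSucc_lt j
  rw [segWeight, portion_pos, portion_pos, padded_val_succ]
  split_ifs <;> first | omega | ring

theorem segWeight_zero (j : Fin n) : P.segWeight j 0 = 0 := by
  have hlt := P.idx_castSucc_lt j
  rw [segWeight]
  split_ifs with hfirst
  · exact P.amt_eq_zero (hfirst ▸ padded_zero _)
  · omega
  · omega
  · rfl

theorem segWeight_card_succ (j : Fin n) : P.segWeight j (m + 1) = 0 := by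
  have hlt := P.idx_castSucc_lt j
  have hle := P.idx_le j.succ
  have hpad : padded M.weight (m + 1) = 0 := padded_of_lt _ m.lt_succ_self
  rw [segWeight]
  split_ifs with hfirst hlast
  · omega
  · rw [P.amt_eq_zero (hlast ▸ hpad), hpad, sub_zero]
  · omega
  · rfl

theorem sum_segWeight_mul (f : ℕ → ℝ) (j : Fin n) :
    ∑ k ∈ Finset.range (m + 2), P.segWeight j k * f k =
      ∑ i : Fin m, (M.portion i (P.pos j.succ) - M.portion i (P.pos j.castSucc)) * f (i + 1) := by
  rw [Finset.sum_range_succ, segWeight_card_succ, Finset.sum_range_succ', segWeight_zero, zero_mul,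
    zero_mul, add_zero, add_zero, Finset.sum_range]
  exact Finset.sum_congr rfl fun i _ => by rw [segWeight_val_succ]

end position

variable {P P' : Splitting M n} {D D' : BSCMix n}

theorem Compounds.weight_eq (h : P.Compounds D) (j : Fin n) :
    D.weight j = P.pos j.succ - P.pos j.castSucc := by
  have hsum := P.sum_segWeight_mul (fun _ => 1) j
  simp only [mul_one, Finset.sum_sub_distrib, BSCMix.sum_portion (P.pos_mem_Icc _)] at hsum
  exact (h j).1.trans hsum

theorem Compounds.weight_mul_cross_eq (h : P.Compounds D) (j : Fin n) :
    D.weight j * D.cross j = M.lorenz (P.pos j.succ) - M.lorenz (P.pos j.castSucc) := by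
  rw [(h j).2, sum_segWeight_mul, BSCMix.lorenz, BSCMix.lorenz, ← Finset.sum_sub_distrib]
  exact Finset.sum_congr rfl fun i _ => by rw [padded_val_succ, sub_mul]

theorem Compounds.pos_castSucc_lt (h : P.Compounds D) (hD : ∀ j, 0 < D.weight j) (j : Fin n) :
    P.pos j.castSucc < P.pos j.succ :=
  sub_pos.mp (h.weight_eq j ▸ hD j)

theorem Compounds.cumWeight_eq_pos (h : P.Compounds D) (j : Fin (n + 1)) :
    D.cumWeight j = P.pos j := by
  induction j using Fin.induction with
  | zero => rw [P.pos_zero, Fin.val_zero, D.cumWeight_zero]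
  | succ j ih =>
    rw [Fin.val_castSucc] at ih
    rw [Fin.val_succ, D.cumWeight_val_succ, ih, h.weight_eq, add_sub_cancel]

theorem Compounds.atom_eq (h : P.Compounds D) (j : Fin n) :
    D.atom j = Set.Icc (P.pos j.castSucc) (P.pos j.succ) := by
  rw [← h.cumWeight_eq_pos, ← h.cumWeight_eq_pos, Fin.val_castSucc, Fin.val_succ]

theorem Compounds.lorenz_pos (h : P.Compounds D) (hD : ∀ j, 0 < D.weight j) (j : Fin (n + 1)) :
    D.lorenz (P.pos j) = M.lorenz (P.pos j) := by
  induction j using Fin.induction with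
  | zero => rw [P.pos_zero, BSCMix.lorenz_zero, BSCMix.lorenz_zero]
  | succ j ih =>
    have hle := (h.pos_castSucc_lt hD j).le
    have hD_sub := BSCMix.lorenz_sub_eq_of_mem_atom (h.atom_eq j ▸ Set.left_mem_Icc.mpr hle)
      (h.atom_eq j ▸ Set.right_mem_Icc.mpr hle)
    rw [← h.weight_eq, h.weight_mul_cross_eq, ih] at hD_sub
    exact sub_left_inj.mp hD_sub

theorem AdjacencyConditions.pos_succ_eq (hadj : P.AdjacencyConditions D) {j : Fin n}
    (hidx : P.idx j.succ = P.idx j.castSucc + 1)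
    (h : P.pos j.castSucc = M.cumWeight (P.idx j.castSucc)) :
    P.pos j.succ = M.cumWeight (P.idx j.succ) :=
  (P.amt_eq_zero_iff_pos_eq _).mp ((hadj j hidx).1 ((P.amt_eq_zero_iff_pos_eq _).mpr h)).1

theorem AdjacencyConditions.pos_castSucc_eq (hadj : P.AdjacencyConditions D) {j : Fin n}
    (hidx : P.idx j.succ = P.idx j.castSucc + 1)
    (h : P.pos j.succ = M.cumWeight (P.idx j.succ - 1)) :
    P.pos j.castSucc = M.cumWeight (P.idx j.castSucc - 1) :=
  (P.amt_eq_padded_iff_pos_eq _).mp ((hadj j hidx).2 ((P.amt_eq_padded_iff_pos_eq _).mpr h)).1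

theorem le_idx_of_cumWeight_le_pos (hw : ∀ i, 0 < M.weight i) {j : Fin (n + 1)} {k : ℕ}
    (hk : k ≤ m) (h : M.cumWeight k ≤ P.pos j) : k ≤ P.idx j := by
  by_contra! hlt
  exact (h.trans (P.pos_le_cumWeight j)).not_gt
    (BSCMix.cumWeight_strictMonoOn hw (hlt.le.trans hk) hk hlt)

theorem idx_le_succ_of_pos_le_cumWeight (hw : ∀ i, 0 < M.weight i) {j : Fin (n + 1)} {k : ℕ}
    (hk : k ≤ m) (h : P.pos j ≤ M.cumWeight k) : P.idx j ≤ k + 1 := by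
  have hle := P.idx_le j
  by_contra! hlt
  exact ((P.cumWeight_pred_le_pos j).trans h).not_gt
    (BSCMix.cumWeight_strictMonoOn hw hk (Set.mem_Iic.mpr (by omega)) (by omega))

theorem AdjacencyConditions.segment_eq_of_subset_atom (hadj : P.AdjacencyConditions D)
    (hw : ∀ i, 0 < M.weight i) {j : Fin n} {i : Fin m}
    (hleft : M.cumWeight i ≤ P.pos j.castSucc) (hright : P.pos j.succ ≤ M.cumWeight (i + 1)) :
    P.pos j.castSucc = M.cumWeight i ∧ P.pos j.succ = M.cumWeight (i + 1) := by
  have hidx := P.idx_castSucc_lt j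
  have hge := le_idx_of_cumWeight_le_pos hw i.isLt.le hleft
  have hle := idx_le_succ_of_pos_le_cumWeight hw i.isLt hright
  have hleft_eq : P.idx j.castSucc = i → P.pos j.castSucc = M.cumWeight i := fun h =>
    (h ▸ P.pos_le_cumWeight j.castSucc).antisymm hleft
  have hright_eq : P.idx j.succ = i + 2 → P.pos j.succ = M.cumWeight (i + 1) := fun h =>
    hright.antisymm (by have hpred := P.cumWeight_pred_le_pos j.succ; rwa [h] at hpred)
  obtain ⟨hl, hr⟩ | ⟨hl, hr⟩ | ⟨hl, hr⟩ :
      (P.idx j.castSucc = i ∧ P.idx j.succ = i + 1) ∨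
      (P.idx j.castSucc = i + 1 ∧ P.idx j.succ = i + 2) ∨
      (P.idx j.castSucc = i ∧ P.idx j.succ = i + 2) := by omega
  · refine ⟨hleft_eq hl, ?_⟩
    rw [hadj.pos_succ_eq (by omega) (by rw [hleft_eq hl, hl]), hr]
  · refine ⟨?_, hright_eq hr⟩
    rw [hadj.pos_castSucc_eq (by omega) (by rw [hright_eq hr, hr]; rfl), hl, Nat.add_sub_cancel]
  · exact ⟨hleft_eq hl, hright_eq hr⟩

theorem exists_segment_subset_atom (hc : StrictMono M.cross) (h : P.Compounds D)
    (hD : ∀ j, 0 < D.weight j) (h' : P'.Compounds D') (hD' : ∀ j, 0 < D'.weight j)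
    (hlorenz : ∀ x ∈ Set.Icc (0 : ℝ) 1, D'.lorenz x ≤ D.lorenz x) {l : Fin (n + 1)} {j : Fin n}
    (hleft : P'.pos j.castSucc < P.pos l) (hright : P.pos l < P'.pos j.succ) :
    ∃ i, P'.pos j.castSucc ∈ M.atom i ∧ P'.pos j.succ ∈ M.atom i := by
  have hle := hlorenz _ (P.pos_mem_Icc l)
  rw [h.lorenz_pos hD] at hle
  have hatom := h'.atom_eq j
  have hmem : P.pos l ∈ D'.atom j := hatom ▸ ⟨hleft.le, hright.le⟩
  have hchord_left := BSCMix.lorenz_sub_eq_of_mem_atom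
    (hatom ▸ Set.left_mem_Icc.mpr (hleft.trans hright).le) hmem
  have hchord_right := BSCMix.lorenz_sub_eq_of_mem_atom hmem
    (hatom ▸ Set.right_mem_Icc.mpr (hleft.trans hright).le)
  rw [h'.lorenz_pos hD'] at hchord_left hchord_right
  exact BSCMix.exists_mem_atom_of_chord_le hc (P'.pos_mem_Icc _) (P'.pos_mem_Icc _) hleft hright
    (c := D'.cross j) (by linarith) (by linarith)

theorem segment_eq_of_subset_segment (hw : ∀ i, 0 < M.weight i) (hc : StrictMono M.cross)
    (h : P.Compounds D) (hD : ∀ j, 0 < D.weight j) (hadj : P.AdjacencyConditions D)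
    (h' : P'.Compounds D') (hD' : ∀ j, 0 < D'.weight j) (hadj' : P'.AdjacencyConditions D')
    (hlorenz : ∀ x ∈ Set.Icc (0 : ℝ) 1, D'.lorenz x ≤ D.lorenz x) {j : Fin n}
    (hleft : P'.pos j.castSucc ≤ P.pos j.castSucc) (hright : P.pos j.succ ≤ P'.pos j.succ) :
    P.pos j.castSucc = P'.pos j.castSucc ∧ P.pos j.succ = P'.pos j.succ := by
  have hlt := h.pos_castSucc_lt hD j
  by_cases hcut : ∃ l, P'.pos j.castSucc < P.pos l ∧ P.pos l < P'.pos j.succ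
  · obtain ⟨l, hl, hr⟩ := hcut
    obtain ⟨i, hi, hi'⟩ := exists_segment_subset_atom hc h hD h' hD' hlorenz hl hr
    have hP := hadj.segment_eq_of_subset_atom hw (hi.1.trans hleft) (hright.trans hi'.2)
    have hP' := hadj'.segment_eq_of_subset_atom hw hi.1 hi'.2
    exact ⟨hP.1.trans hP'.1.symm, hP.2.trans hP'.2.symm⟩
  · push Not at hcut
    constructor
    · by_contra hne
      exact (hcut _ (hleft.lt_of_ne' hne)).not_gt (hlt.trans_le hright)
    · by_contra hne
      exact (hcut _ (hleft.trans_lt hlt)).not_gt (hright.lt_of_ne hne)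

theorem pos_eq_of_lorenz_le (hw : ∀ i, 0 < M.weight i) (hc : StrictMono M.cross)
    (h : P.Compounds D) (hD : ∀ j, 0 < D.weight j) (hadj : P.AdjacencyConditions D)
    (h' : P'.Compounds D') (hD' : ∀ j, 0 < D'.weight j) (hadj' : P'.AdjacencyConditions D')
    (hlorenz : ∀ x ∈ Set.Icc (0 : ℝ) 1, D'.lorenz x ≤ D.lorenz x) : P.pos = P'.pos :=
  eq_of_segment_subset_imp_eq (by rw [pos_zero, pos_zero]) (by rw [pos_last, pos_last])
    fun _ => segment_eq_of_subset_segment hw hc h hD hadj h' hD' hadj' hlorenz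

theorem Compounds.eq_of_pos_eq (h : P.Compounds D) (hD : ∀ j, 0 < D.weight j)
    (h' : P'.Compounds D') (hpos : P.pos = P'.pos) : D = D' := by
  have hweight : D.weight = D'.weight := funext fun j => by
    rw [h.weight_eq, h'.weight_eq, hpos]
  have hcross : D.cross = D'.cross := funext fun j => by
    refine mul_left_cancel₀ (hD j).ne' ?_
    rw [h.weight_mul_cross_eq, hpos, ← h'.weight_mul_cross_eq, hweight]
  cases D
  cases D'
  congr

end Splitting

theorem theorem4_general {m n : ℕ} {Y Y' : Type*} {M : BSCMix m} (hw : ∀ i, 0 < M.weight i)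
    (hc : StrictMono M.cross) {P P' : Splitting M n} {D D' : BSCMix n}
    (hP : P.Compounds D) (hD : D.IsReduced) (hadj : P.AdjacencyConditions D)
    (hP' : P'.Compounds D') (hD' : D'.IsReduced) (hadj' : P'.AdjacencyConditions D')
    {W : BIDMC Y} {W' : BIDMC Y'} (hW : W.Equivalent D.channel) (hW' : W'.Equivalent D'.channel)
    (hle : W.IsDegradationOf W') : W.Equivalent W' := by
  have hlorenz : ∀ x ∈ Set.Icc (0 : ℝ) 1, D'.lorenz x ≤ D.lorenz x := fun x hx =>
    BSCMix.lorenz_le_lorenz_of_isDegradationOf hD.2.2 hD'.2.1.monotone hD'.2.2 hW hW' hle hx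
  have hpos := Splitting.pos_eq_of_lorenz_le hw hc hP hD.1 hadj hP' hD'.1 hadj' hlorenz
  obtain rfl := hP.eq_of_pos_eq hD.1 hP' hpos
  exact fun ε hε => (hW ε hε).trans (hW' ε hε).symm

theorem theorem4 {m n : ℕ} (hn : 2 ≤ n) (hnm : n < m) {A Y Y' : Type*}
    (Q : BIDMC A) (M : BSCMix m) (hM : M.IsReduced) (hQ : Q.Equivalent M.channel)
    (P P' : Splitting M n) (W : BIDMC Y) (W' : BIDMC Y')
    (hW : W.IsPStarDegradation Q P) (hW' : W'.IsPStarDegradation Q P')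
    (hadj : (P.patterns \ P'.patterns).ncard ≤ 2)
    (hle : W.IsDegradationOf W') : W.Equivalent W' := by
  obtain ⟨-, D, hD, hP, hadjP, hWD⟩ := hW
  obtain ⟨-, D', hD', hP', hadjP', hWD'⟩ := hW'
  exact theorem4_general hM.1 hM.2.1 hP hD hadjP hP' hD' hadjP' hWD hWD' hle
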